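/- Let $k$ be a nonnegative integer and let $\Omega\subset\mathbb{R}$ be a nonempty open set. Write $C^k(\Omega)$ for the space of $k$ times continuously differentiable functions $f\colon\Omega\to\mathbb{R}$ and $C(\Omega)=C^0(\Omega)$. Suppose that the linear operator $D\colon C^k(\Omega)\to C(\Omega)$ (no continuity of $D$ is assumed) satisfies $$D(fgh)-fD(gh)-gD(fh)-hD(fg)+fg\,D(h)+fh\,D(g)+gh\,D(f)=0\qquad(\ast)$$ for all $f,g,h\in C^k(\Omega)$. Then there exist functions $c_1,c_2\in C(\Omega)$ such that $$D(f)(x)=c_1(x)f'(x)+c_2(x)f''(x)\qquad(\ast\ast)$$ for all $f\in C^k(\Omega)$ and $x\in\Omega$, where (i) if $k=0$, then $c_1=c_2=0$; (ii) if $k=1$, then $c_2=0$ (a term with zero coefficient is read as $0$, even if the derivative in it does not exist). Conversely, for all $c_1,c_2\in C(\Omega)$ subject to (i) and (ii), formula $(\ast\ast)$ defines an operator $D\colon C^k(\Omega)\to C(\Omega)$, and this operator is linear and satisfies $(\ast)$ for all $f,g,h\in C^k(\Omega)$. -/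

import Mathlib

/-- The extension by zero to the whole line of a function on `Ω ⊆ ℝ`. It is used only to speak of
differentiability and derivatives at points of the open set `Ω`, where the values outside `Ω`
play no role. -/
noncomputable def zeroExtend {Ω : Set ℝ} (f : Ω → ℝ) : ℝ → ℝ :=
  Function.extend Subtype.val f 0

theorem zeroExtend_apply {Ω : Set ℝ} (f : Ω → ℝ) {x : ℝ} (hx : x ∈ Ω) :
    zeroExtend f x = f ⟨x, hx⟩ :=
  Subtype.val_injective.extend_apply f 0 ⟨x, hx⟩

/-- For open `Ω ⊆ ℝ`, the algebra (under pointwise operations) of the `k` times continuously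
differentiable functions `f : Ω → ℝ`. -/
noncomputable def CkFun (k : ℕ) (Ω : Set ℝ) : Subalgebra ℝ (Ω → ℝ) where
  carrier := {f | ContDiffOn ℝ k (zeroExtend f) Ω}
  mul_mem' {f g} hf hg :=
    (ContDiffOn.mul hf hg).congr fun x hx => by simp [zeroExtend_apply _ hx]
  add_mem' {f g} hf hg :=
    (ContDiffOn.add hf hg).congr fun x hx => by simp [zeroExtend_apply _ hx]
  algebraMap_mem' r :=
    (contDiffOn_const (c := r)).congr fun x hx => by simp [zeroExtend_apply _ hx]

/-- The first derivative `f'` of a function on an open set `Ω` of reals. -/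
noncomputable def fstDeriv {Ω : Set ℝ} (f : Ω → ℝ) (x : Ω) : ℝ :=
  deriv (zeroExtend f) x

/-- The second derivative `f''` of a function on an open set `Ω` of reals. -/
noncomputable def sndDeriv {Ω : Set ℝ} (f : Ω → ℝ) (x : Ω) : ℝ :=
  deriv (deriv (zeroExtend f)) x

/-- The identity
`D(fgh) - f D(gh) - g D(fh) - h D(fg) + fg D(h) + fh D(g) + gh D(f) = 0`
for all `f, g, h ∈ C^k(Ω)`, for an arbitrary operator `D : C^k(Ω) → C(Ω)`. -/
def SecondOrderIdentity {k : ℕ} {Ω : Set ℝ} (D : CkFun k Ω → C(Ω, ℝ)) : Prop :=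
  ∀ f g h : CkFun k Ω, ∀ x : Ω,
    D (f * g * h) x - f.1 x * D (g * h) x - g.1 x * D (f * h) x - h.1 x * D (f * g) x
      + f.1 x * g.1 x * D h x + f.1 x * h.1 x * D g x + g.1 x * h.1 x * D f x = 0

/-- The operator `D : C^k(Ω) → C(Ω)` has the form `D(f) = c₁ f' + c₂ f''`, where `c₁ = c₂ = 0` if
`k = 0` and `c₂ = 0` if `k = 1` (so that a derivative which need not exist is multiplied
by zero). -/
def HasForm {k : ℕ} {Ω : Set ℝ} (D : CkFun k Ω → C(Ω, ℝ)) (c₁ c₂ : C(Ω, ℝ)) : Prop :=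
  (k = 0 → c₁ = 0 ∧ c₂ = 0) ∧ (k = 1 → c₂ = 0) ∧
    ∀ (f : CkFun k Ω) (x : Ω), D f x = c₁ x * fstDeriv f.1 x + c₂ x * sndDeriv f.1 x

/-! If `f`, `g`, `h` all vanish at `x`, every term of the identity except `D (f * g * h) x` carries
a vanishing factor, so `D (f * g * h) x = 0`. This makes `D` local: near-zero functions factor
through cutoffs (`apply_eq_zero_of_eventually`).

Locality improves to dependence on the `k`-jet alone (`apply_eq_zero_of_iteratedDeriv`). If the jet
of `f` at `x` vanishes, `f` may be replaced by `0` to the right of `x` without losing `C^k`. The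
image of this hybrid is `0` on the right and `D f` on the left, and both images are continuous, so
`D f x = 0`. No continuity of `D` is needed.

Hence `D f x` is computed on the Taylor polynomial at `x`. Powers `(t - x) ^ j` with `j ≥ 3` are
products of three functions vanishing at `x`, and `D 1 = 0`; only `j = 1, 2` survive and give `c₁`,
`c₂`. The converse is the Leibniz rule. -/

open Filter Topology in
/-- Cutting off to the left of `x₀` preserves `C^k` for functions whose `k`-jet at `x₀` vanishes. -/
theorem contDiffOn_indicator_Iic_of_iteratedDeriv_eq_zero {Ω : Set ℝ} (hΩ : IsOpen Ω) {x₀ : ℝ}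
    (hx₀ : x₀ ∈ Ω) (k : ℕ) {F : ℝ → ℝ} (hF : ContDiffOn ℝ k F Ω)
    (h0 : ∀ j ≤ k, iteratedDeriv j F x₀ = 0) :
    ContDiffOn ℝ k ((Set.Iic x₀).indicator F) Ω := by
  have left : ∀ (G : ℝ → ℝ) {x : ℝ}, x < x₀ → (Set.Iic x₀).indicator G =ᶠ[𝓝 x] G := by
    intro G x hx
    filter_upwards [Iio_mem_nhds hx] with y hy
    exact Set.indicator_of_mem (Set.mem_Iic.2 (le_of_lt (Set.mem_Iio.1 hy))) G
  have right : ∀ (G : ℝ → ℝ) {x : ℝ}, x₀ < x → (Set.Iic x₀).indicator G =ᶠ[𝓝 x] fun _ => 0 := by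
    intro G x hx
    filter_upwards [Ioi_mem_nhds hx] with y hy
    exact Set.indicator_of_notMem (fun h => absurd hy (not_lt.2 (Set.mem_Iic.1 h))) G
  -- At the junction this bound passes `F → 0`, and then `F = o(y - x₀)`, on to the cut-off
  -- function.
  have bound : ∀ (G : ℝ → ℝ) (y : ℝ), ‖(Set.Iic x₀).indicator G y‖ ≤ ‖G y‖ := fun G y =>
    norm_indicator_le_norm_self G y
  induction k generalizing F with
  | zero =>
    have hF' : ContinuousOn F Ω := hF.continuousOn
    have hz : F x₀ = 0 := by simpa using h0 0 le_rfl
    refine contDiffOn_zero.2 fun x hx => ContinuousAt.continuousWithinAt ?_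
    have hc : ContinuousAt F x := hF'.continuousAt (hΩ.mem_nhds hx)
    rcases lt_trichotomy x x₀ with h | rfl | h
    · exact hc.congr (left F h).symm
    · have hi : (Set.Iic x).indicator F x = 0 := by simp [hz]
      rw [ContinuousAt, hi]
      rw [ContinuousAt, hz] at hc
      exact squeeze_zero_norm (bound F) (by simpa using hc.norm)
    · exact continuousAt_const.congr (right F h).symm
  | succ k ih =>
    push_cast at hF ⊢
    rw [contDiffOn_succ_iff_deriv_of_isOpen hΩ] at hF ⊢
    obtain ⟨hd, -, hF'⟩ := hF
    have hz : F x₀ = 0 := by simpa using h0 0 (Nat.zero_le _)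
    have hz' : deriv F x₀ = 0 := by simpa using h0 1 (by omega)
    have key : ∀ x ∈ Ω, HasDerivAt ((Set.Iic x₀).indicator F)
        ((Set.Iic x₀).indicator (deriv F) x) x := by
      intro x hx
      have hc : HasDerivAt F (deriv F x) x :=
        (hd.differentiableAt (hΩ.mem_nhds hx)).hasDerivAt
      rcases lt_trichotomy x x₀ with h | rfl | h
      · rw [(left (deriv F) h).eq_of_nhds]
        exact hc.congr_of_eventuallyEq (left F h)
      · have hi : (Set.Iic x).indicator F x = 0 := by simp [hz]
        have hi' : (Set.Iic x).indicator (deriv F) x = 0 := by simp [hz']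
        rw [hz', hasDerivAt_iff_isLittleO] at hc
        rw [hi', hasDerivAt_iff_isLittleO]
        simp only [hz, hi, smul_zero, sub_zero] at hc ⊢
        exact (Asymptotics.isBigO_of_le _ (bound F)).trans_isLittleO hc
      · rw [(right (deriv F) h).eq_of_nhds]
        exact (hasDerivAt_const x (0 : ℝ)).congr_of_eventuallyEq (right F h)
    refine ⟨fun x hx => (key x hx).differentiableAt.differentiableWithinAt, by simp, ?_⟩
    refine (ih hF' fun j hj => ?_).congr fun x hx => (key x hx).deriv
    rw [← iteratedDeriv_succ']
    exact h0 (j + 1) (by omega)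

theorem iteratedDeriv_sub_const_pow_self (x₀ : ℝ) (i n : ℕ) :
    iteratedDeriv i (fun t : ℝ => (t - x₀) ^ n) x₀ = if i = n then (n.factorial : ℝ) else 0 := by
  rw [iteratedDeriv_comp_sub_const (𝕜 := ℝ) i (fun t : ℝ => t ^ n) x₀]
  simp only [sub_self]
  rw [iteratedDeriv_fun_pow_zero (𝕜 := ℝ)]
  push_cast
  rfl

/-! ### Calculus in `C^k(Ω)` -/

section CkFun

variable {k : ℕ} {Ω : Set ℝ}

open Filter Topology in
theorem zeroExtend_eventuallyEq (hΩ : IsOpen Ω) {f : Ω → ℝ} {F : ℝ → ℝ}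
    (h : ∀ x : Ω, f x = F x) (x : Ω) : zeroExtend f =ᶠ[𝓝 (x : ℝ)] F := by
  filter_upwards [hΩ.mem_nhds x.2] with y hy
  rw [zeroExtend_apply f hy, h ⟨y, hy⟩]

/-- The restriction to `Ω` of a function that is `C^k` on `Ω`. -/
noncomputable def CkFun.ofContDiffOn (F : ℝ → ℝ) (hF : ContDiffOn ℝ k F Ω) : CkFun k Ω :=
  ⟨fun x => F x, hF.congr fun _ hx => zeroExtend_apply _ hx⟩

/-- The function `t ↦ t - a` on `Ω`. -/
noncomputable def CkFun.subConst (a : ℝ) : CkFun k Ω :=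
  CkFun.ofContDiffOn (fun t => t - a) (contDiff_id.sub contDiff_const).contDiffOn

theorem CkFun.subConst_apply (a : ℝ) (x : Ω) : (CkFun.subConst a : CkFun k Ω).1 x = x - a := rfl

theorem zeroExtend_mul (f g : Ω → ℝ) : zeroExtend (f * g) = zeroExtend f * zeroExtend g := by
  funext x
  by_cases hx : x ∈ Ω
  · simp [zeroExtend_apply _ hx]
  · have h : ¬ ∃ a : Ω, (a : ℝ) = x := by rintro ⟨a, rfl⟩; exact hx a.2
    simp [zeroExtend, Function.extend_apply' _ _ _ h]

theorem zeroExtend_add (f g : Ω → ℝ) : zeroExtend (f + g) = zeroExtend f + zeroExtend g := by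
  funext x
  by_cases hx : x ∈ Ω
  · simp [zeroExtend_apply _ hx]
  · have h : ¬ ∃ a : Ω, (a : ℝ) = x := by rintro ⟨a, rfl⟩; exact hx a.2
    simp [zeroExtend, Function.extend_apply' _ _ _ h]

theorem zeroExtend_smul (c : ℝ) (f : Ω → ℝ) : zeroExtend (c • f) = c • zeroExtend f := by
  funext x
  by_cases hx : x ∈ Ω
  · simp [zeroExtend_apply _ hx]
  · have h : ¬ ∃ a : Ω, (a : ℝ) = x := by rintro ⟨a, rfl⟩; exact hx a.2
    simp [zeroExtend, Function.extend_apply' _ _ _ h]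

theorem CkFun.contDiffAt (f : CkFun k Ω) (hΩ : IsOpen Ω) (x : Ω) :
    ContDiffAt ℝ k (zeroExtend f.1) x :=
  f.2.contDiffAt (hΩ.mem_nhds x.2)

theorem CkFun.differentiableAt (f : CkFun k Ω) (hΩ : IsOpen Ω) (hk : 1 ≤ k) (x : Ω) :
    DifferentiableAt ℝ (zeroExtend f.1) x :=
  (CkFun.contDiffAt f hΩ x).differentiableAt (by exact_mod_cast (by omega : k ≠ 0))

theorem CkFun.contDiffOn_deriv (f : CkFun k Ω) (hΩ : IsOpen Ω) {m : ℕ} (hk : m + 1 ≤ k) :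
    ContDiffOn ℝ m (deriv (zeroExtend f.1)) Ω :=
  ContDiffOn.deriv_of_isOpen f.2 hΩ (by exact_mod_cast hk)

theorem CkFun.differentiableAt_deriv (f : CkFun k Ω) (hΩ : IsOpen Ω) (hk : 2 ≤ k) (x : Ω) :
    DifferentiableAt ℝ (deriv (zeroExtend f.1)) x :=
  ((CkFun.contDiffOn_deriv f hΩ (m := 1) hk).contDiffAt (hΩ.mem_nhds x.2)).differentiableAt (by simp)

theorem CkFun.continuous_fstDeriv (f : CkFun k Ω) (hΩ : IsOpen Ω) (hk : 1 ≤ k) :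
    Continuous (fstDeriv f.1) :=
  continuousOn_iff_continuous_domRestrict.1 (CkFun.contDiffOn_deriv f hΩ (m := 0) hk).continuousOn

theorem CkFun.continuous_sndDeriv (f : CkFun k Ω) (hΩ : IsOpen Ω) (hk : 2 ≤ k) :
    Continuous (sndDeriv f.1) :=
  continuousOn_iff_continuous_domRestrict.1
    ((CkFun.contDiffOn_deriv f hΩ (m := 1) hk).continuousOn_deriv_of_isOpen hΩ (by simp))

theorem fstDeriv_add (hΩ : IsOpen Ω) (hk : 1 ≤ k) (f g : CkFun k Ω) (x : Ω) :
    fstDeriv (f + g).1 x = fstDeriv f.1 x + fstDeriv g.1 x := by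
  change deriv (zeroExtend (f.1 + g.1)) x = _
  rw [zeroExtend_add]
  exact deriv_add (CkFun.differentiableAt f hΩ hk x) (CkFun.differentiableAt g hΩ hk x)

/-- No differentiability is needed: the default value `0` of `deriv` also scales. -/
theorem fstDeriv_smul (c : ℝ) (f : Ω → ℝ) (x : Ω) : fstDeriv (c • f) x = c * fstDeriv f x := by
  rw [fstDeriv, zeroExtend_smul]
  exact deriv_const_mul_field c

theorem fstDeriv_mul (hΩ : IsOpen Ω) (hk : 1 ≤ k) (f g : CkFun k Ω) (x : Ω) :
    fstDeriv (f * g).1 x = fstDeriv f.1 x * g.1 x + f.1 x * fstDeriv g.1 x := by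
  change deriv (zeroExtend (f.1 * g.1)) x = _
  rw [zeroExtend_mul, deriv_mul (CkFun.differentiableAt f hΩ hk x) (CkFun.differentiableAt g hΩ hk x),
    zeroExtend_apply _ x.2, zeroExtend_apply _ x.2]
  rfl

theorem sndDeriv_add (hΩ : IsOpen Ω) (hk : 2 ≤ k) (f g : CkFun k Ω) (x : Ω) :
    sndDeriv (f + g).1 x = sndDeriv f.1 x + sndDeriv g.1 x := by
  change deriv (deriv (zeroExtend (f.1 + g.1))) x = _
  have h : deriv (zeroExtend (f.1 + g.1)) =ᶠ[nhds (x : ℝ)]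
      deriv (zeroExtend f.1) + deriv (zeroExtend g.1) := by
    filter_upwards [hΩ.mem_nhds x.2] with y hy
    exact fstDeriv_add hΩ (by omega) f g ⟨y, hy⟩
  rw [h.deriv_eq]
  exact deriv_add (CkFun.differentiableAt_deriv f hΩ hk x) (CkFun.differentiableAt_deriv g hΩ hk x)

theorem sndDeriv_smul (c : ℝ) (f : Ω → ℝ) (x : Ω) : sndDeriv (c • f) x = c * sndDeriv f x := by
  have h : deriv (c • zeroExtend f) = fun y => c * deriv (zeroExtend f) y := by
    funext y
    exact deriv_const_mul_field c
  rw [sndDeriv, zeroExtend_smul, h]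
  exact deriv_const_mul_field c

theorem sndDeriv_mul (hΩ : IsOpen Ω) (hk : 2 ≤ k) (f g : CkFun k Ω) (x : Ω) :
    sndDeriv (f * g).1 x =
      sndDeriv f.1 x * g.1 x + 2 * fstDeriv f.1 x * fstDeriv g.1 x + f.1 x * sndDeriv g.1 x := by
  change deriv (deriv (zeroExtend (f.1 * g.1))) x = _
  have h : deriv (zeroExtend (f.1 * g.1)) =ᶠ[nhds (x : ℝ)]
      deriv (zeroExtend f.1) * zeroExtend g.1 + zeroExtend f.1 * deriv (zeroExtend g.1) := by
    filter_upwards [hΩ.mem_nhds x.2] with y hy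
    rw [zeroExtend_mul]
    exact deriv_mul (CkFun.differentiableAt f hΩ (by omega) ⟨y, hy⟩)
      (CkFun.differentiableAt g hΩ (by omega) ⟨y, hy⟩)
  have hf := CkFun.differentiableAt f hΩ (by omega) x
  have hg := CkFun.differentiableAt g hΩ (by omega) x
  have hf' := CkFun.differentiableAt_deriv f hΩ hk x
  have hg' := CkFun.differentiableAt_deriv g hΩ hk x
  rw [h.deriv_eq, deriv_add (hf'.mul hg) (hf.mul hg'), deriv_mul hf' hg, deriv_mul hf hg',
    zeroExtend_apply _ x.2, zeroExtend_apply _ x.2]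
  simp only [fstDeriv, sndDeriv, Subtype.coe_eta]
  ring

/-! ### From the identity to the form of `D` -/

namespace SecondOrderIdentity

variable {D : CkFun k Ω → C(Ω, ℝ)}

theorem apply_mul_mul_eq_zero (hD : SecondOrderIdentity D) {f g h : CkFun k Ω} {x : Ω}
    (hf : f.1 x = 0) (hg : g.1 x = 0) (hh : h.1 x = 0) : D (f * g * h) x = 0 := by
  simpa [hf, hg, hh] using hD f g h x

/-- With all three arguments `1`, the coefficients add up to `1 - 3 + 3 = 1`. -/
theorem apply_one (hD : SecondOrderIdentity D) (x : Ω) : D 1 x = 0 := by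
  have h := hD 1 1 1 x
  have h1 : (1 : CkFun k Ω).1 x = 1 := rfl
  simp only [mul_one, h1, one_mul] at h
  linarith

theorem apply_subConst_pow (hD : SecondOrderIdentity D) (x : Ω) (n : ℕ) :
    D (CkFun.subConst (x : ℝ) ^ (n + 3)) x = 0 := by
  have hx : (CkFun.subConst (x : ℝ) : CkFun k Ω).1 x = 0 := by simp [CkFun.subConst_apply]
  have hx' : ((CkFun.subConst (x : ℝ) : CkFun k Ω) ^ (n + 1)).1 x = 0 := by
    change ((CkFun.subConst (x : ℝ) : CkFun k Ω).1 x) ^ (n + 1) = 0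
    rw [hx, zero_pow (Nat.succ_ne_zero n)]
  rw [show (CkFun.subConst (x : ℝ) : CkFun k Ω) ^ (n + 3) =
    CkFun.subConst (x : ℝ) ^ (n + 1) * CkFun.subConst (x : ℝ) * CkFun.subConst (x : ℝ) by ring]
  exact hD.apply_mul_mul_eq_zero hx' hx hx

open Filter Topology in
theorem apply_eq_zero_of_eventually (hD : SecondOrderIdentity D) (f : CkFun k Ω)
    (x : Ω) (hf : ∀ᶠ y in 𝓝 x, f.1 y = 0) : D f x = 0 := by
  have hf' : ∀ᶠ y in 𝓝 (x : ℝ), ∀ hy : y ∈ Ω, f.1 ⟨y, hy⟩ = 0 := by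
    rw [nhds_subtype_eq_comap, eventually_comap] at hf
    filter_upwards [hf] with y hy hyΩ
    exact hy ⟨y, hyΩ⟩ rfl
  obtain ⟨r, hr, hball⟩ := Metric.eventually_nhds_iff.1 hf'
  let φ : ContDiffBump (x : ℝ) := ⟨r / 2, r, by positivity, by linarith⟩
  let ψ : CkFun k Ω := CkFun.ofContDiffOn (fun t => 1 - φ t)
    (contDiff_const.sub φ.contDiff).contDiffOn
  have hψ : ψ.1 x = 0 := by
    change 1 - φ x = 0
    rw [φ.eventuallyEq_one.eq_of_nhds]
    simp
  -- `ψ` vanishes at `x` but equals `1` wherever `f` may be nonzero.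
  have hfψ : f * ψ * ψ = f := by
    refine Subtype.ext (funext fun y => ?_)
    change f.1 y * (1 - φ y) * (1 - φ y) = f.1 y
    by_cases hy : dist (y : ℝ) x < r
    · rw [hball hy y.2]; ring
    · rw [φ.zero_of_le_dist (not_lt.1 hy)]; ring
  rw [← hfψ]
  exact hD.apply_mul_mul_eq_zero hf.self_of_nhds hψ hψ

open Filter Topology in
theorem apply_eq_zero_of_iteratedDeriv (hΩ : IsOpen Ω) (hlin : IsLinearMap ℝ D)
    (hD : SecondOrderIdentity D) (f : CkFun k Ω) (x : Ω)
    (hf : ∀ j ≤ k, iteratedDeriv j (zeroExtend f.1) x = 0) : D f x = 0 := by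
  let h : CkFun k Ω := CkFun.ofContDiffOn ((Set.Iic (x : ℝ)).indicator (zeroExtend f.1))
    (contDiffOn_indicator_Iic_of_iteratedDeriv_eq_zero hΩ x.2 k f.2 hf)
  have hle : ∀ y : Ω, y ≤ x → h.1 y = f.1 y := fun y hy =>
    (Set.indicator_of_mem (show (y : ℝ) ∈ Set.Iic (x : ℝ) from hy) _).trans
      (zeroExtend_apply _ y.2)
  have hgt : ∀ y : Ω, x < y → h.1 y = 0 := fun y hy =>
    Set.indicator_of_notMem (s := Set.Iic (x : ℝ)) (a := (y : ℝ))
      (fun h' => absurd hy (not_lt.2 (Set.mem_Iic.1 h'))) _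
  have hright : ∀ y : Ω, x < y → D h y = 0 := fun y hy =>
    hD.apply_eq_zero_of_eventually h y (mem_of_superset (Ioi_mem_nhds hy) hgt)
  have hleft : ∀ y : Ω, y < x → D h y = D f y := fun y hy => by
    have := hD.apply_eq_zero_of_eventually (h - f) y <| by
      filter_upwards [Iio_mem_nhds hy] with z hz
      change h.1 z - f.1 z = 0
      rw [hle z (le_of_lt hz), sub_self]
    rw [hlin.map_sub, ContinuousMap.sub_apply] at this
    linarith
  -- As `Ω` is open, `x` is a limit of points of `Ω` from either side, so one-sided vanishing
  -- reaches `x` by continuity.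
  have approach : ∀ (s : Set ℝ), (𝓝[s] (x : ℝ)).NeBot → ∀ G : C(Ω, ℝ),
      (∀ y : Ω, (y : ℝ) ∈ s → G y = 0) → G x = 0 := by
    intro s hs G hG
    have hmem : x ∈ closure {y : Ω | (y : ℝ) ∈ s} := by
      rw [closure_subtype]
      have : (x : ℝ) ∈ closure (Ω ∩ s) :=
        hΩ.inter_closure ⟨x.2, mem_closure_iff_nhdsWithin_neBot.2 hs⟩
      refine closure_mono ?_ this
      rintro y ⟨hy, hys⟩
      exact ⟨⟨y, hy⟩, hys, rfl⟩
    have hcl : IsClosed {y : Ω | G y = 0} := isClosed_eq G.continuous continuous_const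
    exact hcl.closure_subset_iff.2 (fun y hy => hG y hy) hmem
  have h1 : D h x = 0 := approach (Set.Ioi (x : ℝ)) inferInstance (D h) fun y hy => hright y hy
  have h2 : (D h - D f) x = 0 := approach (Set.Iio (x : ℝ)) inferInstance (D h - D f) fun y hy => by
    rw [ContinuousMap.sub_apply, hleft y hy, sub_self]
  rw [ContinuousMap.sub_apply, h1] at h2
  linarith

/-- An operator satisfying the identity is determined at each point by Taylor polynomials. -/
theorem apply_eq_sum (hΩ : IsOpen Ω) (hlin : IsLinearMap ℝ D) (hD : SecondOrderIdentity D)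
    (f : CkFun k Ω) (x : Ω) :
    D f x = ∑ j ∈ Finset.range (k + 1), iteratedDeriv j (zeroExtend f.1) x / j.factorial *
      D (CkFun.subConst (x : ℝ) ^ j) x := by
  set a : ℕ → ℝ := fun j => iteratedDeriv j (zeroExtend f.1) x / j.factorial
  let P : CkFun k Ω := ∑ j ∈ Finset.range (k + 1), a j • CkFun.subConst (x : ℝ) ^ j
  have hP : D P x = ∑ j ∈ Finset.range (k + 1), a j * D (CkFun.subConst (x : ℝ) ^ j) x := by
    have := map_sum (IsLinearMap.mk' D hlin) (fun j => a j • CkFun.subConst (x : ℝ) ^ j)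
      (Finset.range (k + 1))
    simp only [map_smul, IsLinearMap.mk'_apply] at this
    rw [this, ContinuousMap.sum_apply]
    rfl
  have hval : ∀ y : Ω, (f - P).1 y = zeroExtend f.1 y -
      ∑ j ∈ Finset.range (k + 1), a j * ((y : ℝ) - x) ^ j := by
    intro y
    have h1 : P.1 y = ∑ j ∈ Finset.range (k + 1), a j * ((y : ℝ) - x) ^ j := by
      simp only [P, AddSubmonoidClass.coe_finsetSum, Finset.sum_apply]
      rfl
    change f.1 y - P.1 y = _
    rw [h1, zeroExtend_apply _ y.2]
  have h0 : D (f - P) x = 0 := by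
    refine hD.apply_eq_zero_of_iteratedDeriv hΩ hlin _ x fun i hi => ?_
    rw [(zeroExtend_eventuallyEq hΩ (F := fun t => zeroExtend f.1 t -
      ∑ j ∈ Finset.range (k + 1), a j * (t - x) ^ j) hval x).iteratedDeriv_eq,
      iteratedDeriv_fun_sub ((CkFun.contDiffAt f hΩ x).of_le (by exact_mod_cast hi))
        (ContDiff.contDiffAt (by fun_prop)),
      iteratedDeriv_fun_sum fun j _ => ContDiff.contDiffAt (by fun_prop)]
    simp only [iteratedDeriv_const_mul_field, iteratedDeriv_sub_const_pow_self]
    simp only [mul_ite, mul_zero, Finset.sum_ite_eq, Finset.mem_range]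
    rw [if_pos (by omega)]
    simp only [a]
    rw [div_mul_cancel₀ _ (by exact_mod_cast i.factorial_ne_zero), sub_self]
  rw [hlin.map_sub, ContinuousMap.sub_apply, hP] at h0
  linarith

theorem exists_hasForm (hΩ : IsOpen Ω) (hlin : IsLinearMap ℝ D) (hD : SecondOrderIdentity D) :
    ∃ c₁ c₂ : C(Ω, ℝ), HasForm D c₁ c₂ := by
  have hsub : ∀ x : Ω, D (CkFun.subConst (x : ℝ)) x = D (CkFun.subConst 0) x := by
    intro x
    have : (CkFun.subConst (x : ℝ) : CkFun k Ω) = CkFun.subConst 0 - (x : ℝ) • 1 := by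
      refine Subtype.ext (funext fun y => ?_)
      change (y : ℝ) - x = (y : ℝ) - 0 - x * 1
      ring
    rw [this, hlin.map_sub, hlin.map_smul, ContinuousMap.sub_apply, ContinuousMap.smul_apply,
      hD.apply_one, smul_zero, sub_zero]
  obtain hk | hk | hk : k = 0 ∨ k = 1 ∨ 2 ≤ k := by omega
  · subst hk
    refine ⟨0, 0, fun _ => ⟨rfl, rfl⟩, fun _ => rfl, fun f x => ?_⟩
    rw [hD.apply_eq_sum hΩ hlin]
    simp [hD.apply_one]
  · subst hk
    refine ⟨D (CkFun.subConst 0), 0, fun h => absurd h one_ne_zero, fun _ => rfl, fun f x => ?_⟩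
    rw [hD.apply_eq_sum hΩ hlin]
    simp [Finset.sum_range_succ, hD.apply_one, hsub, fstDeriv, mul_comm]
  -- Half of `D ((t - x) ^ 2) x`, expanded in the fixed functions `t ^ 2` and `t` so that continuity
  -- in `x` is visible.
  · let c₂ : C(Ω, ℝ) := ⟨fun x => (D (CkFun.subConst 0 ^ 2) x - 2 * x * D (CkFun.subConst 0) x) / 2,
      by fun_prop⟩
    have hsq : ∀ x : Ω, D (CkFun.subConst (x : ℝ) ^ 2) x = 2 * c₂ x := by
      intro x
      have : (CkFun.subConst (x : ℝ) : CkFun k Ω) ^ 2 =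
          CkFun.subConst 0 ^ 2 - (2 * x : ℝ) • CkFun.subConst 0 + (x ^ 2 : ℝ) • 1 := by
        refine Subtype.ext (funext fun y => ?_)
        change ((y : ℝ) - x) ^ 2 = ((y : ℝ) - 0) ^ 2 - (2 * x) * ((y : ℝ) - 0) + x ^ 2 * 1
        ring
      rw [this, hlin.map_add, hlin.map_sub, hlin.map_smul, hlin.map_smul, ContinuousMap.add_apply,
        ContinuousMap.sub_apply, ContinuousMap.smul_apply, ContinuousMap.smul_apply,
        hD.apply_one, smul_zero, add_zero, smul_eq_mul]
      simp only [c₂, ContinuousMap.coe_mk]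
      ring
    refine ⟨D (CkFun.subConst 0), c₂, fun h => by omega, fun h => by omega, fun f x => ?_⟩
    -- Splits off `j = 0, 1, 2`, leaving `m` terms with exponent `j + 3`, all zero.
    obtain ⟨m, rfl⟩ : ∃ m, k = m + 2 := ⟨k - 2, by omega⟩
    rw [hD.apply_eq_sum hΩ hlin, Finset.sum_range_succ', Finset.sum_range_succ',
      Finset.sum_range_succ', Finset.sum_eq_zero fun j _ => by rw [hD.apply_subConst_pow, mul_zero]]
    simp only [zero_add, pow_zero, hD.apply_one, mul_zero, add_zero, pow_one, hsub,
      Nat.reduceAdd, hsq, iteratedDeriv_succ, iteratedDeriv_zero, fstDeriv,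
      sndDeriv, Nat.factorial, Nat.cast_one, mul_one]
    ring

end SecondOrderIdentity

/-! ### The converse -/

theorem exists_hasForm_of_coefficients (hΩ : IsOpen Ω) (c₁ c₂ : C(Ω, ℝ))
    (h0 : k = 0 → c₁ = 0 ∧ c₂ = 0) (h1 : k = 1 → c₂ = 0) :
    ∃ D : CkFun k Ω → C(Ω, ℝ), HasForm D c₁ c₂ := by
  have hcont : ∀ f : CkFun k Ω,
      Continuous fun x => c₁ x * fstDeriv f.1 x + c₂ x * sndDeriv f.1 x := by
    intro f
    obtain hk | hk | hk : k = 0 ∨ k = 1 ∨ 2 ≤ k := by omega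
    · simpa [(h0 hk).1, (h0 hk).2] using continuous_const
    · simp only [h1 hk, ContinuousMap.zero_apply, zero_mul, add_zero]
      exact c₁.continuous.mul (CkFun.continuous_fstDeriv f hΩ hk.ge)
    · exact (c₁.continuous.mul (CkFun.continuous_fstDeriv f hΩ (by omega))).add
        (c₂.continuous.mul (CkFun.continuous_sndDeriv f hΩ hk))
  exact ⟨fun f => ⟨_, hcont f⟩, h0, h1, fun _ _ => rfl⟩

namespace HasForm

variable {D : CkFun k Ω → C(Ω, ℝ)} {c₁ c₂ : C(Ω, ℝ)}

theorem isLinearMap (hΩ : IsOpen Ω) (hD : HasForm D c₁ c₂) : IsLinearMap ℝ D := by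
  obtain ⟨h0, h1, hf⟩ := hD
  refine ⟨fun f g => ContinuousMap.ext fun x => ?_, fun c f => ContinuousMap.ext fun x => ?_⟩
  · rw [ContinuousMap.add_apply, hf, hf, hf]
    -- Default values of `deriv` need not add up, but where derivatives may fail to exist the
    -- coefficients vanish.
    obtain hk | hk | hk : k = 0 ∨ k = 1 ∨ 2 ≤ k := by omega
    · simp [(h0 hk).1, (h0 hk).2]
    · rw [h1 hk, fstDeriv_add hΩ hk.ge]
      simp [mul_add]
    · rw [fstDeriv_add hΩ (by omega), sndDeriv_add hΩ hk]
      ring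
  · rw [ContinuousMap.smul_apply, hf, hf, smul_eq_mul]
    change c₁ x * fstDeriv (c • f.1) x + c₂ x * sndDeriv (c • f.1) x = _
    rw [fstDeriv_smul, sndDeriv_smul]
    ring

theorem secondOrderIdentity (hΩ : IsOpen Ω) (hD : HasForm D c₁ c₂) : SecondOrderIdentity D := by
  obtain ⟨h0, h1, hf⟩ := hD
  intro f g h x
  simp only [hf]
  have hfg : (f * g).1 x = f.1 x * g.1 x := rfl
  obtain hk | hk | hk : k = 0 ∨ k = 1 ∨ 2 ≤ k := by omega
  · simp [(h0 hk).1, (h0 hk).2]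
  · simp only [h1 hk, fstDeriv_mul hΩ hk.ge, hfg, ContinuousMap.zero_apply]
    ring
  · simp only [fstDeriv_mul hΩ (show 1 ≤ k by omega), sndDeriv_mul hΩ hk, hfg]
    ring

end HasForm

end CkFun

theorem mainTheorem2 (k : ℕ) (Ω : Set ℝ) (hΩ : IsOpen Ω) (hne : Ω.Nonempty) :
    (∀ D : CkFun k Ω → C(Ω, ℝ), IsLinearMap ℝ D → SecondOrderIdentity D →
      ∃ c₁ c₂ : C(Ω, ℝ), HasForm D c₁ c₂) ∧
    (∀ c₁ c₂ : C(Ω, ℝ), (k = 0 → c₁ = 0 ∧ c₂ = 0) → (k = 1 → c₂ = 0) →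
      (∃ D : CkFun k Ω → C(Ω, ℝ), HasForm D c₁ c₂) ∧
      ∀ D : CkFun k Ω → C(Ω, ℝ), HasForm D c₁ c₂ →
        IsLinearMap ℝ D ∧ SecondOrderIdentity D) :=
  ⟨fun _ hlin hD => hD.exists_hasForm hΩ hlin,
    fun c₁ c₂ h0 h1 => ⟨exists_hasForm_of_coefficients hΩ c₁ c₂ h0 h1,
      fun _ hD => ⟨hD.isLinearMap hΩ, hD.secondOrderIdentity hΩ⟩⟩⟩
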